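/- **Setting.** Let $1\le K\le N$ and $M\ge 2$ be integers, let $\mathbb F$ be a finite field, and let $G\in\mathbb F^{K\times N}$ generate an $(N,K)$-MDS code (any $K$ columns of $G$ are linearly independent). The files $W_1,\dots,W_M$ are independent and uniform in $\mathbb F^{N^M\times K}$, so each has $L=KN^M$ symbols. Server $l\in[0:N-1]$ stores the $l$-th column of $W_mG$ for every $m$. The servers do not collude. All logarithms are to base $2$, and $(x)_+=\max(x,0)$. An information retrieval scheme consists of queries $(Q_l^{\theta})_{l}$, random given the desired index $\theta$ (uniform on $[1:M]$) and independent of the files, and of answers $A_l^{\theta}$, strings of symbols of $\mathbb F$ that are deterministic functions of $Q_l^{\theta}$ and of the data stored by server $l$. It is correct if $H(W_k\mid A^{k}_{[0:N-1]},Q^{k}_{[0:N-1]})=0$ for every $k\in[1:M]$. Its rate is $R=L\log|\mathbb F|/\mathbb E[D]$, where $D$ is the total number of downloaded bits, a symbol counting $\log|\mathbb F|$ bits, and its maximal leakage is $$\rho^{\mathsf{MaxL}}=\max_{l}\ \log\Big(\sum_{q}\max_{m\in[1:M]}\mathsf P_{Q_l^\theta\mid\theta}(q\mid m)\Big).$$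 **The Banawan–Ulukus scheme** on a set $A$ of $s$ files with $N^s$ encoded rows each, with desired file $\theta\in A$. The rows of every file are permuted uniformly at random and independently. In each of $K$ iterations, every server is asked, for every non-empty $T\subseteq A$, for $K^{s-|T|}(N-K)^{|T|-1}$ sums, each of one stored symbol of every file in $T$ ("$T$-sums"). No row of a file is used twice at the same server. The symbols of a row of $\theta$ are requested from one server in the first iteration and from its successive cyclic shifts in the following ones, so from $K$ different servers in all. In each iteration, for $T\not\ni\theta$, the same rows are requested in a $T$-sum from $K$ cyclically consecutive servers, and the same $T$-sum of these rows, which the MDS property then makes known at the other $N-K$ servers too, is added to a symbol of $\theta$ in a $T\cup\{\theta\}$-sum at each of those. **The scheme $\mathcal P_{\mathsf{WBU}}$**, for a probability distribution $\mathsf P_{M'}$ on $[0:M-1]$ and desired file $k$. The client draws $M'\sim\mathsf P_{M'}$. If $M'=0$, it draws a uniformly random set of $K$ servers, each of which sends everything it stores of $W_k$; the other servers get a null query and send nothing. If $M'=m'\ne0$, it draws a uniformly random set $J$ of $m'$ undesired files and runs the Banawan–Ulukus scheme on $J\cup\{k\}$, the $N^M$ rows of the encoded files being grouped into $N^{m'+1}$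 super-rows of $N^{M-m'-1}$ consecutive rows. **Theorem.** For every real $\rho\ge0$, the scheme $\mathcal P_{\mathsf{WBU}}$ with $$\mathsf P_{M'}(0)=\min\Big(\frac{N(2^\rho-1)}{K(M-1)},1\Big)=1-\mathsf P_{M'}(M-1)$$ is correct and achieves $$\rho^{\mathsf{MaxL}}=\min\Big(\rho,\ \log\Big(1+\frac{K(M-1)}{N}\Big)\Big),\qquad R=\left(1+\Big(1-\frac{N(2^\rho-1)}{K(M-1)}\Big)_+\Big(\frac KN+\cdots+\Big(\frac KN\Big)^{M-1}\Big)\right)^{-1}.$$ -/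

import Mathlib

open Finset

/-! ## Information retrieval schemes and their metrics -/

/-- A (non-interactive) information retrieval scheme with `N` servers and `M` files. Each file is a
tuple of symbols of the alphabet `F` indexed by `P`, and server `l` stores `store l W` when the
files are `W`. The scheme consists of the finite set of possible queries, the joint law of the
queries sent to the `N` servers for each desired file index (the client's private random bits are
integrated out), and the answer of each server, a string of symbols of `F` indexed by a finite set
that depends on the query only; the answer is a function of the query and of the stored data. -/
structure IRScheme (N M : ℕ) (P F Share : Type*) (store : Fin N → (Fin M → P → F) → Share) where
  Query : Type
  fintypeQuery : Fintype Query
  queryLaw : Fin M → PMF (Fin N → Query)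
  Slot : Query → Type
  fintypeSlot : ∀ q, Fintype (Slot q)
  answer : Fin N → (q : Query) → Share → Slot q → F

attribute [instance] IRScheme.fintypeQuery IRScheme.fintypeSlot

/-- Conditional Shannon entropy `H(X | Y)` in bits, `X` and `Y` being random variables on a finite
probability space: the expectation of `-log₂ P(X | Y)`. -/
noncomputable def condEntropy {Ω α β : Type*} [Fintype Ω] (μ : PMF Ω) (X : Ω → α) (Y : Ω → β) : ℝ :=
  ∑ ω, (μ ω).toReal *
    -Real.logb 2 ((μ.map (fun ω' => (X ω', Y ω')) (X ω, Y ω)).toReal / (μ.map Y (Y ω)).toReal)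

namespace IRScheme

variable {N M : ℕ} {P F Share : Type*} {store : Fin N → (Fin M → P → F) → Share}

/-- The law of the query seen by server `l` when the desired file index is `m`. -/
noncomputable def serverLaw (C : IRScheme N M P F Share store) (l : Fin N) (m : Fin M) :
    PMF C.Query :=
  (C.queryLaw m).map (fun q => q l)

/-- The maximal leakage privacy metric
`max_l log₂ (∑_q max_m P(Q_l = q | θ = m))`. -/
noncomputable def maxLeakage (C : IRScheme N M P F Share store) : ℝ :=
  ⨆ l : Fin N, Real.logb 2 (∑ q : C.Query, ⨆ m : Fin M, (C.serverLaw l m q).toReal)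

/-- The length in bits of the answer to the query `q`. -/
noncomputable def answerBits [Fintype F] (C : IRScheme N M P F Share store) (q : C.Query) : ℝ :=
  Fintype.card (C.Slot q) * Real.logb 2 (Fintype.card F)

/-- The expected total number of downloaded bits, the desired index being uniform on the `M`
files. -/
noncomputable def expectedDownload [Fintype F] (C : IRScheme N M P F Share store) : ℝ :=
  (∑ k : Fin M, ∑ q : Fin N → C.Query,
    (C.queryLaw k q).toReal * ∑ l : Fin N, C.answerBits (q l)) / M

/-- The rate: file size in bits over expected number of downloaded bits. -/
noncomputable def rate [Fintype P] [Fintype F] (C : IRScheme N M P F Share store) : ℝ :=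
  (Fintype.card P * Real.logb 2 (Fintype.card F)) / C.expectedDownload

/-- All queries together with all answers. -/
def transcript (C : IRScheme N M P F Share store) (ω : (Fin N → C.Query) × (Fin M → P → F)) :
    Σ q : Fin N → C.Query, ∀ l, C.Slot (q l) → F :=
  ⟨ω.1, fun l => C.answer l (ω.1 l) (store l ω.2)⟩

/-- Joint law of queries and files for desired index `k`: the files are uniform and independent of
the queries. -/
noncomputable def jointLaw [Fintype P] [DecidableEq P] [Fintype F] [Nonempty F]
    (C : IRScheme N M P F Share store) (k : Fin M) :
    PMF ((Fin N → C.Query) × (Fin M → P → F)) :=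
  (C.queryLaw k).bind fun q => (PMF.uniformOfFintype (Fin M → P → F)).map fun W => (q, W)

/-- Correctness: for every desired index, the queries and the answers leave no uncertainty about
the desired file. -/
def IsCorrect [Fintype P] [DecidableEq P] [Fintype F] [Nonempty F]
    (C : IRScheme N M P F Share store) : Prop :=
  ∀ k : Fin M, condEntropy (C.jointLaw k) (fun ω => ω.2 k) C.transcript = 0

end IRScheme

/-! ## MDS-coded storage -/

/-- `G` generates an `(N, K)`-MDS code: any `K` of its `N` columns are linearly independent. -/
def IsMDSGenerator {F : Type*} [Field F] {N K : ℕ} (G : Matrix (Fin K) (Fin N) F) : Prop :=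
  ∀ S : Finset (Fin N), S.card = K → LinearIndependent F (fun l : S => fun c : Fin K => G c l)

/-- Files are `N ^ M × K` matrices. Server `l` stores the `l`-th column of the encoded
`N ^ M × N` matrix of each file. -/
def mdsStore {F : Type*} [Field F] {N K : ℕ} (M : ℕ) (G : Matrix (Fin K) (Fin N) F) (l : Fin N)
    (W : Fin M → Fin (N ^ M) × Fin K → F) : Fin M → Fin (N ^ M) → F :=
  fun m r => ∑ c, W m (r, c) * G c l

/-! ## The Banawan–Ulukus query generation

The files are indexed by a finite type `ι`, `s` is their number, and each file has `N ^ s`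
encoded rows. In each of `K` iterations, server `l` is asked, for every non-empty set `T` of files,
for `K ^ (s - |T|) * (N - K) ^ (|T| - 1)` sums, each of one stored symbol of every file in `T`. -/

section BU

variable {N K : ℕ} {ι : Type} [Fintype ι] [DecidableEq ι]

/-- The number of sums of each type with `i` summands asked of each server in each iteration. -/
abbrev buCount (N K s i : ℕ) : ℕ := K ^ (s - i) * (N - K) ^ (i - 1)

/-- The positions in a query: iteration, type, and running number of the sum. -/
abbrev BUSlot (N K : ℕ) (ι : Type) [Fintype ι] : Type :=
  Fin K × Σ T : {T : Finset ι // T.Nonempty}, Fin (buCount N K (Fintype.card ι) T.1.card)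

/-- A query: for each position and each file of its type, the row whose symbol enters the sum. -/
abbrev BUQuery (N K : ℕ) (ι : Type) [Fintype ι] : Type :=
  ∀ x : BUSlot N K ι, {m // m ∈ x.2.1.1} → Fin (N ^ Fintype.card ι)

/-- Labels of the rows of the desired file: a server and a position in one iteration. The symbol of
the row is downloaded in the first iteration at that server, in the others at its cyclic shifts. -/
abbrev BUDesired (N K : ℕ) {ι : Type} [Fintype ι] (θ : ι) : Type :=
  Fin N × Σ T : {T : Finset ι // θ ∈ T}, Fin (buCount N K (Fintype.card ι) T.1.card)

/-- Labels of the rows of an undesired file `m`: an iteration, a first server `a`, a type `T` that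
contains `m` and not `θ`, and a running number. The `T`-sum of the rows with such a label is
downloaded from the `K` servers `a, a + 1, …, a + K - 1`, and serves as known side information in
`T ∪ {θ}`-sums at the `N - K` servers `a + K, …, a + N - 1` (all modulo `N`). -/
abbrev BUSide (N K : ℕ) {ι : Type} [Fintype ι] (θ m : ι) : Type :=
  Fin K × Fin N × Σ T : {T : Finset ι // θ ∉ T ∧ m ∈ T},
    Fin (buCount N K (Fintype.card ι - 1) T.1.card)

theorem card_buDesired (hKN : K ≤ N) (θ : ι) :
    Fintype.card (BUDesired N K θ) = N ^ Fintype.card ι := by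
  classical
  have hs : 0 < Fintype.card ι := Fintype.card_pos_iff.mpr ⟨θ⟩
  have key : ∑ T : {T : Finset ι // θ ∈ T}, buCount N K (Fintype.card ι) T.1.card
      = ∑ U ∈ (univ.erase θ).powerset,
          (N - K) ^ U.card * K ^ ((univ.erase θ : Finset ι).card - U.card) := by
    refine Finset.sum_bij' (fun T _ => T.1.erase θ)
      (fun U _ => ⟨insert θ U, mem_insert_self _ _⟩) ?_ ?_ ?_ ?_ ?_
    · intro T _
      exact mem_powerset.2 (erase_subset_erase _ (subset_univ _))
    · intro U _
      exact mem_univ _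
    · intro T _
      exact Subtype.ext (insert_erase T.2)
    · intro U hU
      exact erase_insert fun h => (mem_erase.1 (mem_powerset.1 hU h)).1 rfl
    · intro T _
      have h1 := card_erase_of_mem T.2
      have h2 : (univ.erase θ : Finset ι).card = Fintype.card ι - 1 :=
        card_erase_of_mem (mem_univ _)
      have h3 : 0 < T.1.card := card_pos.2 ⟨θ, T.2⟩
      rw [h1, h2, mul_comm, show Fintype.card ι - 1 - (T.1.card - 1) = Fintype.card ι - T.1.card by
        omega]
  rw [Finset.sum_pow_mul_eq_add_pow, Nat.sub_add_cancel hKN,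
    card_erase_of_mem (mem_univ _), card_univ] at key
  rw [Fintype.card_prod, Fintype.card_sigma]
  simp only [Fintype.card_fin]
  rw [key, ← pow_succ', Nat.sub_add_cancel hs]

theorem card_buSide (hKN : K ≤ N) (θ m : ι) (h : m ≠ θ) :
    Fintype.card (BUSide N K θ m) ≤ N ^ Fintype.card ι := by
  classical
  have hs : 1 < Fintype.card ι := Fintype.one_lt_card_iff.mpr ⟨m, θ, h⟩
  have hmem : m ∈ (univ.erase θ : Finset ι) := mem_erase.2 ⟨h, mem_univ _⟩
  have hc : ((univ.erase θ).erase m : Finset ι).card = Fintype.card ι - 2 := by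
    rw [card_erase_of_mem hmem, card_erase_of_mem (mem_univ _), card_univ]
    omega
  have key : ∑ T : {T : Finset ι // θ ∉ T ∧ m ∈ T}, buCount N K (Fintype.card ι - 1) T.1.card
      = ∑ U ∈ ((univ.erase θ).erase m).powerset,
          (N - K) ^ U.card * K ^ (((univ.erase θ).erase m : Finset ι).card - U.card) := by
    refine Finset.sum_bij' (fun T _ => T.1.erase m)
      (fun U hU => ⟨insert m U, ?_, mem_insert_self _ _⟩) ?_ ?_ ?_ ?_ ?_
    · intro hθ
      rcases mem_insert.1 hθ with h' | h'
      · exact h h'.symm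
      · exact (mem_erase.1 (mem_erase.1 (mem_powerset.1 hU h')).2).1 rfl
    · intro T _
      refine mem_powerset.2 (erase_subset_erase _ fun x hx => mem_erase.2 ⟨?_, mem_univ _⟩)
      rintro rfl
      exact T.2.1 hx
    · intro U _
      exact mem_univ _
    · intro T _
      exact Subtype.ext (insert_erase T.2.2)
    · intro U hU
      exact erase_insert fun h => (mem_erase.1 (mem_powerset.1 hU h)).1 rfl
    · intro T _
      have h1 := card_erase_of_mem T.2.2
      have h3 : 0 < T.1.card := card_pos.2 ⟨m, T.2.2⟩
      rw [h1, hc, mul_comm, show Fintype.card ι - 2 - (T.1.card - 1)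
        = Fintype.card ι - 1 - T.1.card by omega]
  rw [Finset.sum_pow_mul_eq_add_pow, Nat.sub_add_cancel hKN, hc] at key
  rw [Fintype.card_prod, Fintype.card_prod, Fintype.card_sigma]
  simp only [Fintype.card_fin]
  rw [key, ← pow_succ']
  calc K * N ^ (Fintype.card ι - 2 + 1) ≤ N * N ^ (Fintype.card ι - 2 + 1) :=
        Nat.mul_le_mul_right _ hKN
    _ = N ^ Fintype.card ι := by
        rw [← pow_succ']
        congr 1
        omega

/-- A fixed numbering of the rows of the desired file by their labels. -/
noncomputable def buDesiredRow (hKN : K ≤ N) (θ : ι) :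
    BUDesired N K θ ↪ Fin (N ^ Fintype.card ι) :=
  (Fintype.equivFin _).toEmbedding.trans (Fin.castLEEmb (card_buDesired hKN θ).le)

/-- A fixed numbering of the rows used of an undesired file by their labels. -/
noncomputable def buSideRow (hKN : K ≤ N) (θ m : ι) (h : m ≠ θ) :
    BUSide N K θ m ↪ Fin (N ^ Fintype.card ι) :=
  (Fintype.equivFin _).toEmbedding.trans (Fin.castLEEmb (card_buSide hKN θ m h))

/-- The server `l - c` modulo `N`, for `c ≤ N`. -/
def serverBack (l : Fin N) (c : ℕ) : Fin N := ⟨(l + (N - c)) % N, Nat.mod_lt _ l.pos⟩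

/-- Running numbers of `T`-sums, for `T` not containing the desired file, split as
`K * b + c` with `c < K`. -/
theorem buCount_div_lt {s i : ℕ} (hi : i < s) {j : ℕ} (hj : j < buCount N K s i) :
    j / K < buCount N K (s - 1) i := by
  apply Nat.div_lt_of_lt_mul
  unfold buCount at hj ⊢
  rwa [show s - i = (s - 1 - i) + 1 by omega, pow_succ', mul_assoc] at hj

/-- Running numbers of `T ∪ {θ}`-sums split as `(N - K) * b + c` with `c < N - K`. -/
theorem buCount_div_lt' {s i : ℕ} (hi : 2 ≤ i) {j : ℕ} (hj : j < buCount N K s i) :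
    j / (N - K) < buCount N K (s - 1) (i - 1) := by
  apply Nat.div_lt_of_lt_mul
  unfold buCount at hj ⊢
  rwa [show i - 1 = (i - 1 - 1) + 1 by omega, pow_succ', mul_left_comm,
    show s - i = s - 1 - (i - 1) by omega] at hj

/-- The row (before the random permutation) of file `m` that enters, at server `l`, the sum in
position `x`, when the desired file is `θ`. -/
noncomputable def buRow (hKN : K ≤ N) (θ : ι) (l : Fin N) (x : BUSlot N K ι)
    (m : {m // m ∈ x.2.1.1}) : Fin (N ^ Fintype.card ι) :=
  if h : m.1 = θ then
    buDesiredRow hKN θ (serverBack l x.1, ⟨⟨x.2.1.1, h ▸ m.2⟩, x.2.2⟩)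
  else if hθ : θ ∈ x.2.1.1 then
    buSideRow hKN θ m h (x.1, serverBack l (K + x.2.2 % (N - K)),
      ⟨⟨x.2.1.1.erase θ, notMem_erase _ _, mem_erase.2 ⟨h, m.2⟩⟩,
        ⟨x.2.2 / (N - K), by
          rw [card_erase_of_mem hθ]
          exact buCount_div_lt' (one_lt_card.2 ⟨m.1, m.2, θ, hθ, h⟩) x.2.2.2⟩⟩)
  else
    buSideRow hKN θ m h (x.1, serverBack l (x.2.2 % K),
      ⟨⟨x.2.1.1, hθ, m.2⟩,
        ⟨x.2.2 / K, buCount_div_lt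
          (card_lt_univ_of_notMem hθ) x.2.2.2⟩⟩)

/-- The law of the queries to the `N` servers: the rows of every file are permuted uniformly at
random and independently. -/
noncomputable def buLaw (hKN : K ≤ N) (θ : ι) : PMF (Fin N → BUQuery N K ι) :=
  (PMF.uniformOfFintype (ι → Equiv.Perm (Fin (N ^ Fintype.card ι)))).map
    fun π l x m => π m.1 (buRow hKN θ l x m)

end BU

/-! ## The weakly private scheme -/

/-- The queries: `clean k` asks for everything stored of file `k`, `null` asks for nothing, and
`coded A q` is a Banawan–Ulukus query on the files with indices in `A`. -/
inductive WBUQuery (N K M : ℕ) : Type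
  | clean (k : Fin M)
  | null
  | coded (A : Finset (Fin M)) (q : BUQuery N K A)

namespace WBUQuery

variable {N K M : ℕ}

open Classical in
noncomputable instance : Fintype (WBUQuery N K M) :=
  Fintype.ofSurjective
    (fun t : Fin M ⊕ Unit ⊕ (Σ A : Finset (Fin M), BUQuery N K A) => match t with
      | .inl k => clean k
      | .inr (.inl _) => null
      | .inr (.inr ⟨A, q⟩) => coded A q)
    (fun
      | clean k => ⟨.inl k, rfl⟩
      | null => ⟨.inr (.inl ()), rfl⟩
      | coded A q => ⟨.inr (.inr ⟨A, q⟩), rfl⟩)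

/-- The positions of the symbols in the answer to a query. For a Banawan–Ulukus query on `s` files,
the `N ^ M` rows are grouped into `N ^ s` super-rows of `N ^ (M - s)` rows each, and every sum is a
sum of super-rows. -/
def Slot : WBUQuery N K M → Type
  | clean _ => Fin (N ^ M)
  | null => Empty
  | coded A _ => BUSlot N K A × Fin (N ^ (M - A.card))

noncomputable instance : ∀ q : WBUQuery N K M, Fintype (Slot q)
  | clean _ => inferInstanceAs (Fintype (Fin (N ^ M)))
  | null => inferInstanceAs (Fintype Empty)
  | coded A _ => inferInstanceAs (Fintype (BUSlot N K A × Fin (N ^ (M - A.card))))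

/-- The `u`-th row of super-row `r`; the rows of a super-row are consecutive. -/
def superRow (A : Finset (Fin M)) (r : Fin (N ^ Fintype.card A)) (u : Fin (N ^ (M - A.card))) :
    Fin (N ^ M) :=
  Fin.cast (by
    have h : A.card ≤ M := by simpa using card_le_univ A
    rw [Fintype.card_coe, ← pow_add, Nat.add_sub_cancel' h]) (finProdFinEquiv (r, u))

/-- The answer of a server that stores `Y m` for file `m`. -/
def answer {F : Type*} [AddCommMonoid F] (Y : Fin M → Fin (N ^ M) → F) :
    ∀ q : WBUQuery N K M, Slot q → F
  | clean k => fun r => Y k r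
  | null => fun e => e.elim
  | coded A q => fun xu => ∑ m : {m // m ∈ xu.1.2.1.1}, Y m.1.1 (superRow A (q xu.1 m) xu.2)

end WBUQuery

/-- The law of the queries when the desired file is `k` and the number `M'` of additional files has
law `p`. If `M' = 0`, a uniformly random set of `K` servers gets the query `clean k`, the others get
`null`. Otherwise `M'` undesired files are chosen uniformly at random, and the Banawan–Ulukus
queries on these and the desired file are used. -/
noncomputable def wbuLaw {N K M : ℕ} (hKN : K ≤ N) (p : PMF (Fin M)) (k : Fin M) :
    PMF (Fin N → WBUQuery N K M) :=
  p.bind fun m' =>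
    if m'.1 = 0 then
      (PMF.uniformOfFinset (powersetCard K (univ : Finset (Fin N)))
        (powersetCard_nonempty.2 (by simpa using hKN))).map
          fun S l => if l ∈ S then .clean k else .null
    else
      (PMF.uniformOfFinset (powersetCard m'.1 (univ.erase k))
        (powersetCard_nonempty.2 (by
          rw [card_erase_of_mem (mem_univ _), card_univ, Fintype.card_fin]
          exact Nat.le_sub_one_of_lt m'.2))).bind
        fun J => (buLaw hKN (⟨k, mem_insert_self k J⟩ : {m // m ∈ insert k J})).map
          fun q l => .coded (insert k J) (q l)

/-- The weakly private scheme for MDS-coded storage with generator matrix `G`, in which the number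
of additional files has law `p`. -/
noncomputable def wbuScheme {F : Type*} [Field F] {N K M : ℕ} (hKN : K ≤ N)
    (G : Matrix (Fin K) (Fin N) F) (p : PMF (Fin M)) :
    IRScheme N M (Fin (N ^ M) × Fin K) F (Fin M → Fin (N ^ M) → F) (mdsStore M G) where
  Query := WBUQuery N K M
  fintypeQuery := inferInstance
  queryLaw := wbuLaw hKN p
  Slot := WBUQuery.Slot
  fintypeSlot := inferInstance
  answer := fun _ q Y => WBUQuery.answer Y q

/-! The prescribed distribution has only the atoms `M' = 0` and `M' = M - 1`, and in the second the
choice of undesired files is forced. So the query law is a mixture of a clean branch and a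
Banawan–Ulukus branch on all files (`wbuLaw_apply`), and leakage and rate are computed from this
mixture.

Correctness (`wbuScheme_isCorrect`) holds for every distribution. Answers are linear in the files,
so it suffices that zero answers force a zero desired file. `K` servers determine a codeword of an
MDS code. Interference without the desired file is seen by `K` consecutive servers, hence known
everywhere; after its removal each desired row is seen by `K` servers (`bu_decodable`).

Leakage: a single server never sees a row of a file twice, whatever the desired file
(`buRow_injective`), so random row permutations make its Banawan–Ulukus query independent of the
index (`map_apply_buLaw_eq`). Only clean queries leak, and each has probability `P(0) * K / N` under
its own index and zero under the others. Hence the sum of maxima is `1 + P(0) * K * (M - 1) / N`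
(`sum_iSup_map_wbuLaw`).

Rate: the clean branch downloads one file size, the coded branch that size times `∑ i < M, (K / N) ^
i`. -/

/-! ## Decodability implies correctness -/

/-- If `Y` determines `X` on the support, then the conditional entropy of `X` given `Y` is zero. -/
theorem condEntropy_eq_zero {Ω α β : Type*} [Fintype Ω] (μ : PMF Ω) (X : Ω → α) (Y : Ω → β)
    (h : ∀ ω ∈ μ.support, ∀ ω' ∈ μ.support, Y ω = Y ω' → X ω = X ω') :
    condEntropy μ X Y = 0 := by
  unfold condEntropy
  refine sum_eq_zero fun ω _ => ?_
  by_cases hω : μ ω = 0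
  · simp [hω]
  have key : μ.map (fun ω' => (X ω', Y ω')) (X ω, Y ω) = μ.map Y (Y ω) := by
    rw [PMF.map_apply, PMF.map_apply]
    refine tsum_congr fun ω' => ?_
    by_cases hω' : μ ω' = 0
    · simp [hω']
    by_cases hY : Y ω = Y ω'
    · simp [hY, h ω hω ω' hω' hY]
    · simp [hY]
  rw [key]
  -- Both cases give a zero term: `0 / 0 = 0` and `Real.logb 2 0 = 0` by convention, so positivity
  -- of this mass need not be shown.
  rcases eq_or_ne (μ.map Y (Y ω)).toReal 0 with h0 | h0
  · rw [h0, zero_div, Real.logb_zero, neg_zero, mul_zero]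
  · rw [div_self h0, Real.logb_one, neg_zero, mul_zero]

/-- The transcript contains the queries, so two outcomes with equal transcripts share `q`. Entropy
thus reduces to a deterministic statement for each possible `q`. -/
theorem IRScheme.isCorrect_of_decodable {N M : ℕ} {P F Share : Type*}
    {store : Fin N → (Fin M → P → F) → Share} [Fintype P] [DecidableEq P] [Fintype F] [Nonempty F]
    (C : IRScheme N M P F Share store)
    (h : ∀ k, ∀ q ∈ (C.queryLaw k).support, ∀ W W' : Fin M → P → F,
      (∀ l, C.answer l (q l) (store l W) = C.answer l (q l) (store l W')) → W k = W' k) :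
    C.IsCorrect := by
  intro k
  refine condEntropy_eq_zero _ _ _ ?_
  rintro ⟨q, W⟩ hω ⟨q', W'⟩ - hY
  have hq : q ∈ (C.queryLaw k).support := by
    rw [IRScheme.jointLaw, PMF.mem_support_bind_iff] at hω
    obtain ⟨q₁, hq₁, hω⟩ := hω
    rw [PMF.mem_support_map_iff] at hω
    obtain ⟨W₁, -, hW₁⟩ := hω
    rw [← (Prod.mk.inj hW₁).1]
    exact hq₁
  simp only [IRScheme.transcript, Sigma.mk.injEq] at hY
  obtain ⟨rfl, hA⟩ := hY
  exact h k q hq W W' fun l => congrFun (eq_of_heq hA) l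

/-! ## Cyclic shifts and MDS codes -/

section Shift

variable {N K : ℕ}

/-- The server `a + t` modulo `N`. -/
def serverForward (a : Fin N) (t : ℕ) : Fin N := ⟨(a + t) % N, Nat.mod_lt _ a.pos⟩

theorem serverBack_serverForward (a : Fin N) {t : ℕ} (ht : t ≤ N) :
    serverBack (serverForward a t) t = a := by
  apply Fin.ext
  have ha := a.2
  simp only [serverBack, serverForward, Nat.mod_add_mod]
  rw [show (a : ℕ) + t + (N - t) = a + N by omega, Nat.add_mod_right, Nat.mod_eq_of_lt ha]

theorem serverForward_serverBack (l : Fin N) {t : ℕ} (ht : t ≤ N) :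
    serverForward (serverBack l t) t = l := by
  apply Fin.ext
  have ha := l.2
  simp only [serverBack, serverForward, Nat.mod_add_mod]
  rw [show (l : ℕ) + (N - t) + t = l + N by omega, Nat.add_mod_right, Nat.mod_eq_of_lt ha]

theorem serverForward_injOn (a : Fin N) {t t' : ℕ} (ht : t < N) (ht' : t' < N)
    (h : serverForward a t = serverForward a t') : t = t' := by
  have h1 : (a + t) ≡ (a + t') [MOD N] := congrArg Fin.val h
  have h2 := Nat.ModEq.add_left_cancel' _ h1
  rwa [Nat.ModEq, Nat.mod_eq_of_lt ht, Nat.mod_eq_of_lt ht'] at h2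

theorem serverBack_injOn (l : Fin N) {t t' : ℕ} (ht : t < N) (ht' : t' < N)
    (h : serverBack l t = serverBack l t') : t = t' := by
  have h1 := serverForward_serverBack l ht.le
  have h2 := serverForward_serverBack l ht'.le
  rw [← h] at h2
  exact serverForward_injOn _ ht ht' (h1.trans h2.symm)

variable {F : Type*} [Field F] {G : Matrix (Fin K) (Fin N) F}

/-- `K` independent columns span `F ^ K`, so the linear functional with coefficients `v`, which
vanishes on them, is zero. -/
theorem IsMDSGenerator.eq_zero (hG : IsMDSGenerator G) {S : Finset (Fin N)} (hS : S.card = K)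
    {v : Fin K → F} (hv : ∀ l ∈ S, ∑ c, v c * G c l = 0) : v = 0 := by
  have hli := hG S hS
  have hspan : Submodule.span F (Set.range fun l : S => fun c : Fin K => G c l) = ⊤ :=
    hli.span_eq_top_of_card_eq_finrank' (by simp [hS])
  have hφ : Fintype.linearCombination F v = 0 := by
    refine LinearMap.ext_on_range hspan fun l => ?_
    rw [Fintype.linearCombination_apply]
    simpa [mul_comm] using hv l l.2
  funext c
  have := LinearMap.congr_fun hφ (Pi.single c 1)
  simpa using this

theorem IsMDSGenerator.eq_zero_of_cyclic (hG : IsMDSGenerator G) (hKN : K ≤ N) (a : Fin N)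
    {v : Fin K → F} (hv : ∀ t < K, ∑ c, v c * G c (serverForward a t) = 0) : v = 0 := by
  refine hG.eq_zero (S := (range K).image (serverForward a)) ?_ ?_
  · rw [card_image_of_injOn, card_range]
    intro t ht t' ht' h
    rw [coe_range, Set.mem_Iio] at ht ht'
    exact serverForward_injOn a (ht.trans_le hKN) (ht'.trans_le hKN) h
  · simpa using hv

end Shift

/-! ## Decoding the Banawan–Ulukus scheme -/

section Decoding

variable {N K : ℕ} {ι : Type} [Fintype ι] [DecidableEq ι]

theorem sum_subtype_mem_eq_add_erase {ι A : Type*} [DecidableEq ι] [AddCommMonoid A] {T : Finset ι}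
    {θ : ι} (hθ : θ ∈ T) (f : {m // m ∈ T} → A) :
    ∑ m, f m = f ⟨θ, hθ⟩ + ∑ m : {m // m ∈ T.erase θ}, f ⟨m.1, mem_of_mem_erase m.2⟩ := by
  let g : ι → A := fun m => if h : m ∈ T then f ⟨m, h⟩ else 0
  have h1 : ∑ m, f m = ∑ m ∈ T, g m := by
    rw [← sum_coe_sort T g]
    exact sum_congr rfl fun m _ => by simp [g]
  have h2 : ∑ m : {m // m ∈ T.erase θ}, f ⟨m.1, mem_of_mem_erase m.2⟩ = ∑ m ∈ T.erase θ, g m := by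
    rw [← sum_coe_sort (T.erase θ) g]
    exact sum_congr rfl fun m _ => by simp [g, mem_of_mem_erase m.2]
  rw [h1, h2, ← add_sum_erase T g hθ]
  simp [g, hθ]

theorem buRow_desired (hKN : K ≤ N) (θ : ι) (l : Fin N) (x : BUSlot N K ι) (hθ : θ ∈ x.2.1.1) :
    buRow hKN θ l x ⟨θ, hθ⟩ = buDesiredRow hKN θ (serverBack l x.1, ⟨⟨x.2.1.1, hθ⟩, x.2.2⟩) :=
  dif_pos rfl

theorem buRow_of_mem (hKN : K ≤ N) (θ : ι) (l : Fin N) (x : BUSlot N K ι) (hθ : θ ∈ x.2.1.1)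
    (m : {m // m ∈ x.2.1.1}) (h : m.1 ≠ θ) :
    buRow hKN θ l x m = buSideRow hKN θ m h (x.1, serverBack l (K + x.2.2 % (N - K)),
      ⟨⟨x.2.1.1.erase θ, notMem_erase _ _, mem_erase.2 ⟨h, m.2⟩⟩,
        ⟨x.2.2 / (N - K), by
          rw [card_erase_of_mem hθ]
          exact buCount_div_lt' (one_lt_card.2 ⟨m.1, m.2, θ, hθ, h⟩) x.2.2.2⟩⟩) := by
  rw [buRow, dif_neg h, dif_pos hθ]

theorem buRow_of_notMem (hKN : K ≤ N) (θ : ι) (l : Fin N) (x : BUSlot N K ι) (hθ : θ ∉ x.2.1.1)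
    (m : {m // m ∈ x.2.1.1}) (h : m.1 ≠ θ) :
    buRow hKN θ l x m = buSideRow hKN θ m h (x.1, serverBack l (x.2.2 % K),
      ⟨⟨x.2.1.1, hθ, m.2⟩,
        ⟨x.2.2 / K, buCount_div_lt
          (card_lt_univ_of_notMem hθ) x.2.2.2⟩⟩) := by
  rw [buRow, dif_neg h, dif_neg hθ]

/-- The labels are exactly as many as the rows, so recovering all labelled rows recovers the whole
desired file. -/
theorem buDesiredRow_surjective (hKN : K ≤ N) (θ : ι) :
    Function.Surjective (buDesiredRow hKN θ) :=
  ((Fintype.bijective_iff_injective_and_card _).2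
    ⟨(buDesiredRow hKN θ).injective, by rw [card_buDesired hKN, Fintype.card_fin]⟩).2

variable {F : Type*} [Field F] {G : Matrix (Fin K) (Fin N) F}

/-- The rows entering the interference are jointly decoded from `K` cyclically consecutive
servers. -/
theorem bu_interference_eq_zero (hG : IsMDSGenerator G) (hKN : K ≤ N) (θ : ι)
    (D : ι → Fin (N ^ Fintype.card ι) → Fin K → F)
    (hD : ∀ l x, ∑ m, ∑ c, D m.1 (buRow hKN θ l x m) c * G c l = 0)
    (i : Fin K) (a : Fin N) (T : Finset ι) (hT : T.Nonempty) (hθ : θ ∉ T)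
    (b : Fin (buCount N K (Fintype.card ι - 1) T.card)) :
    ∑ m : {m // m ∈ T}, D m.1 (buSideRow hKN θ m.1 (fun h => hθ (h ▸ m.2))
      (i, a, ⟨⟨T, hθ, m.2⟩, b⟩)) = 0 := by
  refine hG.eq_zero_of_cyclic hKN a fun t ht => ?_
  -- At server `a + t` the sum numbered `K * b + t` has quotient `b` and remainder `t`; stepping
  -- back by `t` gives `a`. All `K` servers of the window therefore use the same label `(i, a, T,
  -- b)`.
  have hlt : K * b + t < buCount N K (Fintype.card ι) T.card := by
    have hs : T.card < Fintype.card ι := card_lt_univ_of_notMem hθ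
    have hb := b.2
    unfold buCount at hb ⊢
    rw [show Fintype.card ι - T.card = (Fintype.card ι - 1 - T.card) + 1 by omega, pow_succ',
      mul_assoc]
    calc K * b + t < K * (b + 1) := by rw [mul_add, mul_one]; omega
      _ ≤ _ := Nat.mul_le_mul_left _ hb
  have h := hD (serverForward a t) (i, ⟨⟨T, hT⟩, ⟨K * b + t, hlt⟩⟩)
  rw [sum_comm] at h
  simp_rw [← sum_mul] at h
  rw [← h]
  refine sum_congr rfl fun c _ => ?_
  rw [Finset.sum_apply]
  congr 1
  refine sum_congr rfl fun m _ => ?_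
  rw [buRow_of_notMem hKN θ _ (i, ⟨⟨T, hT⟩, ⟨K * b + t, hlt⟩⟩) hθ m (fun h => hθ (h ▸ m.2))]
  have h1 : (K * b + t) % K = t := by rw [Nat.mul_add_mod, Nat.mod_eq_of_lt ht]
  have h2 : (K * b + t) / K = b := by
    rw [Nat.mul_add_div (by omega), Nat.div_eq_of_lt ht, add_zero]
  simp only [h1, h2, serverBack_serverForward a (ht.le.trans hKN)]

/-- Files that give zero answers to all Banawan–Ulukus queries have a zero desired file. -/
theorem bu_decodable (hG : IsMDSGenerator G) (hKN : K ≤ N) (θ : ι)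
    (D : ι → Fin (N ^ Fintype.card ι) → Fin K → F)
    (hD : ∀ l x, ∑ m, ∑ c, D m.1 (buRow hKN θ l x m) c * G c l = 0) : D θ = 0 := by
  funext r
  obtain ⟨⟨a, ⟨⟨T, hθ⟩, j⟩⟩, rfl⟩ := buDesiredRow_surjective hKN θ r
  refine hG.eq_zero_of_cyclic hKN a fun t ht => ?_
  -- In iteration `t` the row labelled `(a, T, j)` is requested from server `a + t`.
  let x : BUSlot N K ι := (⟨t, ht⟩, ⟨⟨T, ⟨θ, hθ⟩⟩, j⟩)
  have h := hD (serverForward a t) x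
  rw [sum_subtype_mem_eq_add_erase (T := T) hθ] at h
  have hz : ∑ m : {m // m ∈ T.erase θ}, ∑ c, D m.1
      (buRow hKN θ (serverForward a t) x ⟨m.1, mem_of_mem_erase m.2⟩) c *
        G c (serverForward a t) = 0 := by
    rcases (T.erase θ).eq_empty_or_nonempty with he | hne
    · exact Fintype.sum_eq_zero _ fun m => absurd m.2 (by simp [he])
    · rw [sum_comm]
      refine sum_eq_zero fun c _ => ?_
      rw [← sum_mul]
      have hcard : 2 ≤ T.card := by
        have := card_pos.2 hne
        rw [card_erase_of_mem hθ] at this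
        omega
      -- The interference is the symbol at this server of a sum of rows that was already shown to
      -- vanish through its own window of `K` servers.
      have hv := bu_interference_eq_zero hG hKN θ D hD ⟨t, ht⟩
        (serverBack (serverForward a t) (K + j % (N - K))) (T.erase θ) hne (notMem_erase _ _)
        ⟨j / (N - K), by
          rw [card_erase_of_mem hθ]
          exact buCount_div_lt' hcard j.2⟩
      rw [← zero_mul (G c (serverForward a t)), ← Pi.zero_apply (M := fun _ : Fin K => F) c, ← hv,
        Finset.sum_apply]
      congr 1
      refine sum_congr rfl fun m _ => ?_
      rw [buRow_of_mem hKN θ _ x hθ ⟨m.1, mem_of_mem_erase m.2⟩ (mem_erase.1 m.2).1]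
  rw [hz, add_zero, buRow_desired] at h
  rw [← h]
  simp only [x, serverBack_serverForward a (ht.le.trans hKN)]

end Decoding

/-! ## Privacy of the Banawan–Ulukus scheme -/

/-- The two ranges are in bijection, and on a finite type such a bijection extends to a permutation.
-/
theorem exists_perm_apply_eq {X α : Type*} [Finite α] {f g : X → α} (hf : Function.Injective f)
    (hg : Function.Injective g) : ∃ σ : Equiv.Perm α, ∀ x, σ (f x) = g x := by
  classical
  cases nonempty_fintype α
  let e : {a // a ∈ Set.range f} ≃ {a // a ∈ Set.range g} :=
    (Equiv.ofInjective f hf).symm.trans (Equiv.ofInjective g hg)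
  refine ⟨e.extendSubtype, fun x => ?_⟩
  rw [e.extendSubtype_apply_of_mem (f x) ⟨x, rfl⟩]
  change (Equiv.ofInjective g hg ((Equiv.ofInjective f hf).symm ⟨f x, _⟩) : α) = g x
  rw [Equiv.ofInjective_symm_apply, Equiv.ofInjective_apply]

theorem map_equiv_uniformOfFintype {α : Type*} [Fintype α] [Nonempty α] (e : α ≃ α) :
    (PMF.uniformOfFintype α).map e = PMF.uniformOfFintype α := by
  classical
  ext a
  rw [PMF.map_apply, tsum_eq_single (e.symm a)]
  · simp
  · intro b hb
    rw [if_neg]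
    rintro rfl
    exact hb (e.symm_apply_apply b).symm

section Privacy

variable {N K : ℕ} {ι : Type} [Fintype ι] [DecidableEq ι]

/-- For `i ≥ 2` the factor `(N - K) ^ (i - 1)` is zero unless `K < N`, so a running number can only
exist when `N - K` is a usable divisor. -/
theorem buCount_pos_lt {s i j : ℕ} (hi : 2 ≤ i) (hj : j < buCount N K s i) : K < N := by
  by_contra! h
  rw [buCount, Nat.sub_eq_zero_of_le h, zero_pow (by omega), mul_zero] at hj
  exact Nat.not_lt_zero _ hj

theorem add_mod_lt_of_buCount {s i j : ℕ} (hi : 2 ≤ i) (hj : j < buCount N K s i) :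
    K + j % (N - K) < N := by
  have h := buCount_pos_lt hi hj
  have := Nat.mod_lt j (Nat.sub_pos_of_lt h)
  omega

/-- No row of a file is used twice at the same server. -/
theorem buRow_injective (hKN : K ≤ N) (θ : ι) (l : Fin N) (m : ι) :
    Function.Injective fun x : {x : BUSlot N K ι // m ∈ x.2.1.1} =>
      buRow hKN θ l x.1 ⟨m, x.2⟩ := by
  rintro ⟨⟨i, ⟨⟨T, hT⟩, j⟩⟩, hm⟩ ⟨⟨i', ⟨⟨T', hT'⟩, j'⟩⟩, hm'⟩ h
  have hi : (i : ℕ) < N := i.2.trans_le hKN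
  have hi' : (i' : ℕ) < N := i'.2.trans_le hKN
  have hK : 0 < K := i.pos
  change m ∈ T at hm
  change m ∈ T' at hm'
  dsimp only at h
  by_cases hmθ : m = θ
  · subst hmθ
    rw [buRow_desired (x := (i, ⟨⟨T, hT⟩, j⟩)), buRow_desired (x := (i', ⟨⟨T', hT'⟩, j'⟩))] at h
    have h := (buDesiredRow hKN m).injective h
    simp only [Prod.mk.injEq, Sigma.mk.injEq, Subtype.mk.injEq] at h
    obtain ⟨h1, rfl, h3⟩ := h
    obtain rfl := Fin.ext (serverBack_injOn l hi hi' h1)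
    obtain rfl := eq_of_heq h3
    rfl
  · have two_le : ∀ {S : Finset ι}, m ∈ S → θ ∈ S → 2 ≤ S.card := fun h1 h2 =>
      one_lt_card.2 ⟨m, h1, θ, h2, hmθ⟩
    by_cases hθ : θ ∈ T <;> by_cases hθ' : θ ∈ T'
    · rw [buRow_of_mem (x := (i, ⟨⟨T, hT⟩, j⟩)) hKN θ l hθ ⟨m, hm⟩ hmθ,
        buRow_of_mem (x := (i', ⟨⟨T', hT'⟩, j'⟩)) hKN θ l hθ' ⟨m, hm'⟩ hmθ] at h
      have h := (buSideRow hKN θ m hmθ).injective h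
      simp only [Prod.mk.injEq, Sigma.mk.injEq, Subtype.mk.injEq] at h
      obtain ⟨rfl, h1, h2, h3⟩ := h
      obtain rfl : T = T' := by rw [← insert_erase hθ, h2, insert_erase hθ']
      have h3 := Fin.mk.inj (eq_of_heq h3)
      have h4 := serverBack_injOn l (add_mod_lt_of_buCount (two_le hm hθ) j.2)
        (add_mod_lt_of_buCount (two_le hm hθ) j'.2) h1
      obtain rfl : j = j' := by
        apply Fin.ext
        rw [← Nat.div_add_mod j (N - K), h3, Nat.add_left_cancel h4, Nat.div_add_mod]
      rfl
    -- Side information steps back by at least `K`, a fresh sum by less than `K`. Both steps are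
    -- below `N`, so the first servers `a` in the labels differ.
    · rw [buRow_of_mem (x := (i, ⟨⟨T, hT⟩, j⟩)) hKN θ l hθ ⟨m, hm⟩ hmθ,
        buRow_of_notMem (x := (i', ⟨⟨T', hT'⟩, j'⟩)) hKN θ l hθ' ⟨m, hm'⟩ hmθ] at h
      have h := (buSideRow hKN θ m hmθ).injective h
      have h1 := congrArg (fun p => p.2.1) h
      have h4 := serverBack_injOn l (add_mod_lt_of_buCount (two_le hm hθ) j.2)
        ((Nat.mod_lt _ hK).trans_le hKN) h1
      have := Nat.mod_lt (j' : ℕ) hK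
      dsimp only at h4
      omega
    · rw [buRow_of_notMem (x := (i, ⟨⟨T, hT⟩, j⟩)) hKN θ l hθ ⟨m, hm⟩ hmθ,
        buRow_of_mem (x := (i', ⟨⟨T', hT'⟩, j'⟩)) hKN θ l hθ' ⟨m, hm'⟩ hmθ] at h
      have h := (buSideRow hKN θ m hmθ).injective h
      have h1 := congrArg (fun p => p.2.1) h
      have h4 := serverBack_injOn l ((Nat.mod_lt _ hK).trans_le hKN)
        (add_mod_lt_of_buCount (two_le hm' hθ') j'.2) h1
      have := Nat.mod_lt (j : ℕ) hK
      dsimp only at h4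
      omega
    · rw [buRow_of_notMem (x := (i, ⟨⟨T, hT⟩, j⟩)) hKN θ l hθ ⟨m, hm⟩ hmθ,
        buRow_of_notMem (x := (i', ⟨⟨T', hT'⟩, j'⟩)) hKN θ l hθ' ⟨m, hm'⟩ hmθ] at h
      have h := (buSideRow hKN θ m hmθ).injective h
      simp only [Prod.mk.injEq, Sigma.mk.injEq, Subtype.mk.injEq] at h
      obtain ⟨rfl, h1, rfl, h3⟩ := h
      have h3 := Fin.mk.inj (eq_of_heq h3)
      have h4 := serverBack_injOn l ((Nat.mod_lt _ hK).trans_le hKN)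
        ((Nat.mod_lt _ hK).trans_le hKN) h1
      obtain rfl : j = j' := by
        apply Fin.ext
        rw [← Nat.div_add_mod j K, h3, h4, Nat.div_add_mod]
      rfl

/-- The law of the Banawan–Ulukus query seen by one server does not depend on the desired file. -/
theorem map_apply_buLaw_eq (hKN : K ≤ N) (θ θ' : ι) (l : Fin N) :
    (buLaw hKN θ).map (fun q => q l) = (buLaw hKN θ').map fun q => q l := by
  -- For each file, `σ m` carries the rows used at server `l` for `θ` to those used for `θ'`. Right
  -- multiplication by `σ` preserves the uniform law on permutations and turns one query into the
  -- other.
  choose σ hσ using fun m : ι =>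
    exists_perm_apply_eq (buRow_injective hKN θ l m) (buRow_injective hKN θ' l m)
  have hu := map_equiv_uniformOfFintype
    (Equiv.mulRight (σ : ι → Equiv.Perm (Fin (N ^ Fintype.card ι))))
  rw [buLaw, buLaw, PMF.map_comp, PMF.map_comp]
  nth_rw 1 [← hu]
  rw [PMF.map_comp]
  congr 1
  funext π x m
  exact congrArg (π m.1) (hσ m.1 ⟨x, m.2⟩)

end Privacy

/-! ## Correctness of the weakly private scheme -/

section Scheme

variable {N K M : ℕ}

/-- The queries of the branch without additional files. -/
noncomputable def cleanLaw (hKN : K ≤ N) (k : Fin M) : PMF (Fin N → WBUQuery N K M) :=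
  (PMF.uniformOfFinset (powersetCard K (univ : Finset (Fin N)))
    (powersetCard_nonempty.2 (by simpa using hKN))).map
      fun S l => if l ∈ S then .clean k else .null

/-- The queries of the branch in which all files are used. -/
noncomputable def fullLaw (hKN : K ≤ N) (k : Fin M) : PMF (Fin N → WBUQuery N K M) :=
  (buLaw hKN (⟨k, mem_univ k⟩ : {m // m ∈ (univ : Finset (Fin M))})).map
    fun q l => .coded univ (q l)

theorem superRow_surjective (A : Finset (Fin M)) (r : Fin (N ^ M)) :
    ∃ r' u, WBUQuery.superRow (N := N) A r' u = r := by
  have h : N ^ Fintype.card A * N ^ (M - A.card) = N ^ M := by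
    have h : A.card ≤ M := by simpa using card_le_univ A
    rw [Fintype.card_coe, ← pow_add, Nat.add_sub_cancel' h]
  obtain ⟨⟨r', u⟩, hx⟩ := finProdFinEquiv.surjective (Fin.cast h.symm r)
  refine ⟨r', u, ?_⟩
  rw [WBUQuery.superRow, hx]
  rfl

theorem mem_support_wbuLaw (hKN : K ≤ N) (p : PMF (Fin M)) (k : Fin M)
    {q : Fin N → WBUQuery N K M} (hq : q ∈ (wbuLaw hKN p k).support) :
    (∃ S : Finset (Fin N), S.card = K ∧ q = fun l => if l ∈ S then .clean k else .null) ∨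
    ∃ (A : Finset (Fin M)) (hk : k ∈ A) (π : A → Equiv.Perm (Fin (N ^ Fintype.card A))),
      q = fun l => .coded A fun x m => π m.1 (buRow hKN ⟨k, hk⟩ l x m) := by
  rw [wbuLaw, PMF.mem_support_bind_iff] at hq
  obtain ⟨m', -, hq⟩ := hq
  split_ifs at hq
  · rw [PMF.mem_support_map_iff] at hq
    obtain ⟨S, hS, rfl⟩ := hq
    rw [PMF.mem_support_uniformOfFinset_iff] at hS
    exact .inl ⟨S, (mem_powersetCard.1 hS).2, rfl⟩
  · rw [PMF.mem_support_bind_iff] at hq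
    obtain ⟨J, -, hq⟩ := hq
    rw [PMF.mem_support_map_iff] at hq
    obtain ⟨q', hq', rfl⟩ := hq
    rw [buLaw, PMF.mem_support_map_iff] at hq'
    obtain ⟨π, -, rfl⟩ := hq'
    exact .inr ⟨insert k J, mem_insert_self k J, π, rfl⟩

/-- The type of an answer depends on the query; keeping the query a variable allows substitution
instead of transport. -/
theorem WBUQuery.eq_of_answer_clean_eq {F : Type*} [AddCommMonoid F] {k : Fin M}
    {Y Y' : Fin M → Fin (N ^ M) → F} {q : WBUQuery N K M} (hq : q = .clean k)
    (h : WBUQuery.answer Y q = WBUQuery.answer Y' q) : Y k = Y' k := by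
  subst hq
  exact h

theorem wbuScheme_isCorrect {F : Type*} [Field F] [Fintype F] (hKN : K ≤ N)
    {G : Matrix (Fin K) (Fin N) F} (hG : IsMDSGenerator G) (p : PMF (Fin M)) :
    (wbuScheme hKN G p).IsCorrect := by
  refine IRScheme.isCorrect_of_decodable _ fun k q hq W W' h => ?_
  obtain ⟨S, hS, rfl⟩ | ⟨A, hk, π, rfl⟩ := mem_support_wbuLaw hKN p k hq
  · funext ⟨r, c⟩
    have hz : (fun c => W k (r, c) - W' k (r, c)) = 0 := by
      refine hG.eq_zero hS fun l hl => ?_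
      have := congrFun (WBUQuery.eq_of_answer_clean_eq (if_pos hl) (h l)) r
      simp only [mdsStore] at this
      simp only [sub_mul, sum_sub_distrib, this, sub_self]
    exact sub_eq_zero.1 (congrFun hz c)
  · funext ⟨r, c⟩
    obtain ⟨r', u, rfl⟩ := superRow_surjective A r
    -- The permutations and a fixed offset `u` within super-rows are absorbed into the array of
    -- differences, leaving the unpermuted scheme.
    have hz := bu_decodable hG hKN (⟨k, hk⟩ : {m // m ∈ A})
      (fun m r c => W m.1 (WBUQuery.superRow A (π m r) u, c) -
        W' m.1 (WBUQuery.superRow A (π m r) u, c)) fun l x => by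
        have := congrFun (h l) (x, u)
        simp only [wbuScheme, WBUQuery.answer, mdsStore] at this
        simp only [sub_mul, sum_sub_distrib, this, sub_self]
    have hz' := congrFun (congrFun hz ((π ⟨k, hk⟩).symm r')) c
    simp only [Equiv.apply_symm_apply] at hz'
    exact sub_eq_zero.1 hz'

/-! ## The law of the queries -/

theorem PMF.bind_eq_of_forall_mem_support {α β : Type*} {p : PMF α} {f : α → PMF β} {μ : PMF β}
    (h : ∀ a ∈ p.support, f a = μ) : p.bind f = μ := by
  rw [← PMF.bind_const p μ]
  ext b
  rw [PMF.bind_apply, PMF.bind_apply]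
  refine tsum_congr fun a => ?_
  by_cases ha : p a = 0
  · rw [ha, zero_mul, zero_mul]
  · rw [h a ha]

theorem map_coded_buLaw_eq_fullLaw (hKN : K ≤ N) (k : Fin M) {A : Finset (Fin M)} (hA : A = univ)
    (hk : k ∈ A) :
    ((buLaw hKN (⟨k, hk⟩ : {m // m ∈ A})).map fun q l => (.coded A (q l) : WBUQuery N K M)) =
      fullLaw hKN k := by
  subst hA
  rfl

/-- A set of `M - 1` undesired files contains all of them, so the inner random choice is trivial at
the second atom. `M ≥ 2` keeps the atoms distinct. -/
theorem wbuLaw_apply (hM : 2 ≤ M) (hKN : K ≤ N) {p : PMF (Fin M)}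
    {i j : Fin M} (hi : i.1 = 0) (hj : j.1 = M - 1) (hp : ∀ m, m ≠ i ∧ m ≠ j → p m = 0) (k : Fin M)
    (q : Fin N → WBUQuery N K M) :
    wbuLaw hKN p k q =
      p i * cleanLaw hKN k q + p j * fullLaw hKN k q := by
  have h0 : j.1 ≠ 0 := by omega
  have hij : i ≠ j := fun h => h0 (h ▸ hi)
  rw [wbuLaw, PMF.bind_apply, tsum_fintype,
    Fintype.sum_eq_add i j hij (fun m hm => by rw [hp m hm, zero_mul])]
  rw [if_pos hi, if_neg h0]
  congr 2
  refine DFunLike.congr_fun (PMF.bind_eq_of_forall_mem_support fun J hJ => ?_) q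
  rw [PMF.mem_support_uniformOfFinset_iff, mem_powersetCard] at hJ
  apply map_coded_buLaw_eq_fullLaw
  rw [eq_of_subset_of_card_le hJ.1 (by
    rw [card_erase_of_mem (mem_univ _), card_univ, Fintype.card_fin, hJ.2, hj])]
  exact insert_erase (mem_univ _)

theorem PMF.sum_toReal {α : Type*} [Fintype α] (μ : PMF α) : ∑ a, (μ a).toReal = 1 := by
  rw [← ENNReal.toReal_sum fun a _ => μ.apply_ne_top a,
    ← tsum_fintype (L := .unconditional _), μ.tsum_coe, ENNReal.toReal_one]

theorem PMF.sum_toReal_mul_eq {α : Type*} [Fintype α] (μ : PMF α) {f : α → ℝ} {c : ℝ}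
    (h : ∀ a ∈ μ.support, f a = c) : ∑ a, (μ a).toReal * f a = c := by
  rw [← one_mul c, ← PMF.sum_toReal μ, sum_mul]
  refine sum_congr rfl fun a _ => ?_
  by_cases ha : μ a = 0
  · simp [ha]
  · rw [h a ha]

/-! ## The rate -/

/-- When `a` is added, the sets avoiding it contribute `K` times the old sum, and those containing
it give `(K + d) ^ A.card` by the binomial theorem, which is the new term `i = 0`. The geometric
form needs no division by `d`, which is zero for `K = N`. -/
theorem sum_nonempty_pow_mul_pow {α : Type*} [DecidableEq α] (A : Finset α) (K d : ℕ) :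
    ∑ T ∈ A.powerset with T.Nonempty, K ^ (A.card - T.card) * d ^ (T.card - 1) =
      ∑ i ∈ range A.card, (K + d) ^ (A.card - 1 - i) * K ^ i := by
  induction A using Finset.induction_on with
  | empty => simp
  | insert a A ha ih =>
    rw [sum_filter] at ih ⊢
    rw [sum_powerset_insert ha, card_insert_of_notMem ha, sum_range_succ']
    congr 1
    · rw [show ∑ i ∈ range A.card, (K + d) ^ (A.card + 1 - 1 - (i + 1)) * K ^ (i + 1) =
        K * ∑ i ∈ range A.card, (K + d) ^ (A.card - 1 - i) * K ^ i by
          rw [mul_sum]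
          refine sum_congr rfl fun i _ => ?_
          rw [show A.card + 1 - 1 - (i + 1) = A.card - 1 - i by omega]
          ring, ← ih, mul_sum]
      refine sum_congr rfl fun T hT => ?_
      have := card_le_card (mem_powerset.1 hT)
      rw [mul_ite, mul_zero, Nat.sub_add_comm this, pow_succ']
      simp only [mul_assoc]
    · rw [add_comm K d, Nat.add_sub_cancel, Nat.sub_zero, pow_zero, mul_one,
        ← sum_pow_mul_eq_add_pow]
      refine sum_congr rfl fun T hT => ?_
      have haT : a ∉ T := fun h => ha (mem_powerset.1 hT h)
      rw [if_pos (insert_nonempty _ _), card_insert_of_notMem haT, Nat.add_sub_add_right,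
        Nat.add_sub_cancel, mul_comm]

theorem card_buSlot (hKN : K ≤ N) (ι : Type) [Fintype ι] :
    Fintype.card (BUSlot N K ι) = K * ∑ i ∈ range (Fintype.card ι),
      N ^ (Fintype.card ι - 1 - i) * K ^ i := by
  classical
  rw [Fintype.card_prod, Fintype.card_sigma, Fintype.card_fin]
  simp only [Fintype.card_fin]
  congr 1
  have h := sum_nonempty_pow_mul_pow (univ : Finset ι) K (N - K)
  rw [Nat.add_sub_cancel' hKN, card_univ] at h
  rw [← h, powerset_univ, ← sum_subtype_eq_sum_filter]
  exact sum_bij' (fun T _ => ⟨T.1, T.2⟩) (fun T _ => ⟨T.1, T.2⟩) (by simp) (by simp) (by simp)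
    (by simp) (by simp)

section Rate

/-- The length in bits over the alphabet `F` of the answer to a query. -/
noncomputable def WBUQuery.bits (F : Type*) [Fintype F] (q : WBUQuery N K M) : ℝ :=
  Fintype.card q.Slot * Real.logb 2 (Fintype.card F)

variable {F : Type*} [Fintype F]

theorem WBUQuery.bits_clean (k : Fin M) :
    (clean k : WBUQuery N K M).bits F = (N : ℝ) ^ M * Real.logb 2 (Fintype.card F) := by
  have h : Fintype.card (clean k : WBUQuery N K M).Slot = N ^ M := Fintype.card_fin _
  rw [bits, h, Nat.cast_pow]

theorem WBUQuery.bits_null : (null : WBUQuery N K M).bits F = 0 := by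
  have h : Fintype.card (null : WBUQuery N K M).Slot = 0 := Fintype.card_empty
  rw [bits, h, Nat.cast_zero, zero_mul]

theorem WBUQuery.bits_coded_univ (hKN : K ≤ N) (q) :
    (coded univ q : WBUQuery N K M).bits F =
      K * (∑ i ∈ range M, (N : ℝ) ^ (M - 1 - i) * (K : ℝ) ^ i) *
        Real.logb 2 (Fintype.card F) := by
  have h : Fintype.card (coded univ q : WBUQuery N K M).Slot =
      K * ∑ i ∈ range M, N ^ (M - 1 - i) * K ^ i := by
    refine (Fintype.card_prod (BUSlot N K {m // m ∈ (univ : Finset (Fin M))}) _).trans ?_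
    rw [card_buSlot hKN, Fintype.card_fin, Fintype.card_coe, card_univ, Fintype.card_fin,
      Nat.sub_self, pow_zero, mul_one]
  rw [bits, h]
  push_cast
  rfl

theorem sum_cleanLaw_bits (hKN : K ≤ N) (k : Fin M) :
    ∑ q : Fin N → WBUQuery N K M, (cleanLaw hKN k q).toReal * ∑ l, (q l).bits F =
      K * (N : ℝ) ^ M * Real.logb 2 (Fintype.card F) := by
  refine PMF.sum_toReal_mul_eq _ fun q hq => ?_
  rw [cleanLaw, PMF.mem_support_map_iff] at hq
  obtain ⟨S, hS, rfl⟩ := hq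
  rw [PMF.mem_support_uniformOfFinset_iff, mem_powersetCard] at hS
  simp only [apply_ite (WBUQuery.bits F), WBUQuery.bits_clean, WBUQuery.bits_null]
  rw [← sum_filter, filter_mem_eq_inter, univ_inter, sum_const, hS.2, nsmul_eq_mul, mul_assoc]

theorem sum_fullLaw_bits (hKN : K ≤ N) (k : Fin M) :
    ∑ q : Fin N → WBUQuery N K M, (fullLaw hKN k q).toReal * ∑ l, (q l).bits F =
      N * (K * (∑ i ∈ range M, (N : ℝ) ^ (M - 1 - i) * (K : ℝ) ^ i) *
        Real.logb 2 (Fintype.card F)) := by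
  refine PMF.sum_toReal_mul_eq _ fun q hq => ?_
  rw [fullLaw, PMF.mem_support_map_iff] at hq
  obtain ⟨q', -, rfl⟩ := hq
  rw [sum_congr rfl fun l _ => WBUQuery.bits_coded_univ hKN (q' l), sum_const, card_univ,
    Fintype.card_fin, nsmul_eq_mul]

theorem mul_sum_pow_mul_pow (hN : 0 < N) :
    (N : ℝ) * ∑ i ∈ range M, (N : ℝ) ^ (M - 1 - i) * (K : ℝ) ^ i =
      (N : ℝ) ^ M * ∑ i ∈ range M, ((K : ℝ) / N) ^ i := by
  have hN' : (N : ℝ) ≠ 0 := by positivity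
  rw [mul_sum, mul_sum]
  refine sum_congr rfl fun i hi => ?_
  have hi := mem_range.1 hi
  rw [div_pow, ← mul_assoc, ← pow_succ', mul_div_assoc', eq_div_iff (by positivity), mul_right_comm,
    ← pow_add]
  congr 2
  omega

variable [Field F] {G : Matrix (Fin K) (Fin N) F}

theorem wbuScheme_expectedDownload (hM : 2 ≤ M) (hN : 0 < N) (hKN : K ≤ N) {p : PMF (Fin M)}
    {i j : Fin M} (hi : i.1 = 0) (hj : j.1 = M - 1) (hp : ∀ m, m ≠ i ∧ m ≠ j → p m = 0) :
    (wbuScheme hKN G p).expectedDownload =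
      K * (N : ℝ) ^ M * Real.logb 2 (Fintype.card F) * ((p i).toReal +
        (p j).toReal * ∑ i ∈ range M, ((K : ℝ) / N) ^ i) := by
  have hk : ∀ k : Fin M, ∑ q : Fin N → WBUQuery N K M, (wbuLaw hKN p k q).toReal *
      ∑ l, (q l).bits F =
      K * (N : ℝ) ^ M * Real.logb 2 (Fintype.card F) * ((p i).toReal +
        (p j).toReal * ∑ i ∈ range M, ((K : ℝ) / N) ^ i) := fun k => by
    have h : ∀ q, (wbuLaw hKN p k q).toReal = (p i).toReal * (cleanLaw hKN k q).toReal +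
        (p j).toReal * (fullLaw hKN k q).toReal := fun q => by
      rw [wbuLaw_apply hM hKN hi hj hp, ENNReal.toReal_add, ENNReal.toReal_mul, ENNReal.toReal_mul]
      · exact ENNReal.mul_ne_top (p.apply_ne_top _) (PMF.apply_ne_top _ _)
      · exact ENNReal.mul_ne_top (p.apply_ne_top _) (PMF.apply_ne_top _ _)
    simp only [h, add_mul, sum_add_distrib, mul_assoc _ _ (∑ l, _), ← mul_sum]
    rw [sum_cleanLaw_bits, sum_fullLaw_bits]
    linear_combination (p j).toReal * K * Real.logb 2 (Fintype.card F) *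
      mul_sum_pow_mul_pow (K := K) (M := M) hN
  have hM' : (M : ℝ) ≠ 0 := by positivity
  rw [IRScheme.expectedDownload, div_eq_iff hM', mul_comm _ (M : ℝ)]
  refine (sum_congr rfl fun k _ => hk k).trans ?_
  rw [sum_const, card_univ, Fintype.card_fin, nsmul_eq_mul]

theorem wbuScheme_rate (hM : 2 ≤ M) (hK : 1 ≤ K) (hKN : K ≤ N) {p : PMF (Fin M)}
    {i j : Fin M} (hi : i.1 = 0) (hj : j.1 = M - 1) (hp : ∀ m, m ≠ i ∧ m ≠ j → p m = 0) :
    (wbuScheme hKN G p).rate = ((p i).toReal +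
        (p j).toReal * ∑ i ∈ range M, ((K : ℝ) / N) ^ i)⁻¹ := by
  have hN : 0 < N := by omega
  have hlog : Real.logb 2 (Fintype.card F) ≠ 0 :=
    (Real.logb_pos one_lt_two (by exact_mod_cast Fintype.one_lt_card)).ne'
  have hK' : (K : ℝ) ≠ 0 := by positivity
  have hN' : (N : ℝ) ≠ 0 := by positivity
  rw [IRScheme.rate, wbuScheme_expectedDownload hM hN hKN hi hj hp, Fintype.card_prod,
    Fintype.card_fin, Fintype.card_fin, Nat.cast_mul, Nat.cast_pow, mul_comm ((N : ℝ) ^ M) (K : ℝ), ← div_div,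
    div_self (by positivity), one_div]

end Rate

/-! ## The leakage -/

/-- The sets avoiding `l` number `(N - 1).choose K`, and `N * (N - 1).choose K = (N - K) * N.choose
K`. Thus a given server is chosen with probability `K / N`. -/
theorem mul_card_filter_mem_powersetCard (hKN : K ≤ N) (l : Fin N) :
    N * {S ∈ powersetCard K (univ : Finset (Fin N)) | l ∈ S}.card = K * N.choose K := by
  have hN := l.pos
  have h1 := card_filter_add_card_filter_not (s := powersetCard K (univ : Finset (Fin N)))
    fun S => l ∈ S
  have h2 : {S ∈ powersetCard K (univ : Finset (Fin N)) | l ∉ S} =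
      powersetCard K (univ.erase l) := by
    ext S
    simp only [mem_filter, mem_powersetCard, subset_univ, true_and, subset_erase]
    tauto
  rw [h2, card_powersetCard, card_powersetCard, card_erase_of_mem (mem_univ _), card_univ,
    Fintype.card_fin] at h1
  have h3 := Nat.choose_mul_succ_eq (N - 1) K
  rw [Nat.sub_add_cancel hN] at h3
  zify [hKN] at h1 h3 ⊢
  linear_combination (N : ℤ) * h1 - h3

theorem cleanLaw_map_clean (hKN : K ≤ N) (l : Fin N) (m k : Fin M) :
    (((cleanLaw hKN m).map fun q => q l) (.clean k)).toReal =
      if m = k then (K : ℝ) / N else 0 := by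
  classical
  have hC : (N.choose K : ℝ) ≠ 0 := by exact_mod_cast (Nat.choose_pos hKN).ne'
  have hN : (N : ℝ) ≠ 0 := by exact_mod_cast l.pos.ne'
  rw [cleanLaw, PMF.map_comp]
  split_ifs with h
  · subst h
    rw [← PMF.toOuterMeasure_apply_singleton, PMF.toOuterMeasure_map_apply,
      PMF.toOuterMeasure_uniformOfFinset_apply, card_powersetCard, card_univ, Fintype.card_fin,
      ENNReal.toReal_div, ENNReal.toReal_natCast, ENNReal.toReal_natCast, div_eq_div_iff hC hN]
    rw [mul_comm]
    have h := mul_card_filter_mem_powersetCard hKN l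
    have h2 : ∀ S : Finset (Fin N), S ∈ ((fun q => q l) ∘ fun (S : Finset (Fin N)) l =>
        if l ∈ S then (.clean m : WBUQuery N K M) else .null) ⁻¹' {.clean m} ↔ l ∈ S := fun S => by
      by_cases hl : l ∈ S <;> simp [hl]
    simp only [h2]
    exact_mod_cast h
  · rw [PMF.map_apply, tsum_fintype, sum_eq_zero, ENNReal.toReal_zero]
    intro S _
    rw [if_neg]
    dsimp only [Function.comp_apply]
    split_ifs
    · exact fun h' => h (WBUQuery.clean.inj h').symm
    · exact fun h' => by cases h'

/-- Apart from clean queries only `null` occurs, and whether it does depends on the random set of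
servers alone. -/
theorem cleanLaw_map_congr (hKN : K ≤ N) (l : Fin N) (m m' : Fin M) {q : WBUQuery N K M}
    (hq : q ∉ Set.range WBUQuery.clean) :
    ((cleanLaw hKN m).map fun q => q l) q = ((cleanLaw hKN m').map fun q => q l) q := by
  classical
  have h : ∀ k, q ≠ .clean k := fun k h => hq ⟨k, h.symm⟩
  rw [cleanLaw, cleanLaw, PMF.map_comp, PMF.map_comp, PMF.map_apply, PMF.map_apply]
  refine tsum_congr fun S => ?_
  by_cases hl : l ∈ S <;> simp [hl, h]

theorem fullLaw_map_congr (hKN : K ≤ N) (l : Fin N) (m m' : Fin M) :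
    (fullLaw hKN m).map (fun q => q l) = (fullLaw hKN m').map fun q => q l := by
  have h := congrArg (PMF.map (WBUQuery.coded univ)) (map_apply_buLaw_eq hKN
    (⟨m, mem_univ m⟩ : {m // m ∈ (univ : Finset (Fin M))}) ⟨m', mem_univ m'⟩ l)
  rw [PMF.map_comp, PMF.map_comp] at h
  rw [fullLaw, fullLaw, PMF.map_comp, PMF.map_comp]
  exact h

theorem fullLaw_map_clean (hKN : K ≤ N) (l : Fin N) (m k : Fin M) :
    ((fullLaw hKN m).map fun q => q l) (.clean k) = 0 := by
  rw [fullLaw, PMF.map_comp, PMF.apply_eq_zero_iff, PMF.mem_support_map_iff]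
  rintro ⟨q, -, h⟩
  cases h

theorem PMF.map_apply_of_mixture {α β : Type*} {μ μ₁ μ₂ : PMF α} {a b : ENNReal}
    (h : ∀ x, μ x = a * μ₁ x + b * μ₂ x) (f : α → β) (y : β) :
    μ.map f y = a * μ₁.map f y + b * μ₂.map f y := by
  classical
  rw [PMF.map_apply, PMF.map_apply, PMF.map_apply, ← ENNReal.tsum_mul_left, ← ENNReal.tsum_mul_left,
    ← ENNReal.tsum_add]
  refine tsum_congr fun x => ?_
  split_ifs
  · exact h x
  · simp

theorem sum_iSup_map_wbuLaw (hM : 2 ≤ M)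
    (hKN : K ≤ N) {p : PMF (Fin M)}
    {i j : Fin M} (hi : i.1 = 0) (hj : j.1 = M - 1) (hp : ∀ m, m ≠ i ∧ m ≠ j → p m = 0)
    (l : Fin N) :
    ∑ q : WBUQuery N K M, ⨆ m, ((wbuLaw hKN p m).map (fun q => q l) q).toReal =
      1 + (p i).toReal * (K * ((M : ℝ) - 1) / N) := by
  have hne : Nonempty (Fin M) := ⟨i⟩
  set a := (p i).toReal
  have hlaw : ∀ m q, (wbuLaw hKN p m).map (fun q => q l) q =
      p i * ((cleanLaw hKN m).map fun q => q l) q +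
        p j * ((fullLaw hKN m).map fun q => q l) q := fun m q =>
    PMF.map_apply_of_mixture (fun x => wbuLaw_apply hM hKN hi hj hp m x) _ q
  have hclean : ∀ m k : Fin M, ((wbuLaw hKN p m).map (fun q => q l) (.clean k)).toReal =
      if m = k then a * (K / N) else 0 := fun m k => by
    rw [hlaw, fullLaw_map_clean, mul_zero, add_zero, ENNReal.toReal_mul, cleanLaw_map_clean,
      mul_ite, mul_zero]
  have hconst : ∀ q ∉ Set.range WBUQuery.clean, ∀ m, ((wbuLaw hKN p m).map (fun q => q l) q) =
      (wbuLaw hKN p i).map (fun q => q l) q := fun q hq m => by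
    rw [hlaw, hlaw, cleanLaw_map_congr hKN l m i hq, fullLaw_map_congr hKN l m i]
  have hsup : ∀ k : Fin M, ⨆ m, ((wbuLaw hKN p m).map (fun q => q l) (.clean k)).toReal =
      a * (K / N) := fun k => by
    have h0 : 0 ≤ a * ((K : ℝ) / N) := by positivity
    simp only [hclean]
    refine le_antisymm (ciSup_le fun m => ?_) ?_
    · split_ifs
      · exact le_rfl
      · exact h0
    · refine le_ciSup_of_le (Set.finite_range _).bddAbove k ?_
      rw [if_pos rfl]
  have hinj : Function.Injective (WBUQuery.clean : Fin M → WBUQuery N K M) := fun _ _ h =>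
    WBUQuery.clean.inj h
  -- The maxima are compared with the law for one reference file, whose total mass is 1; the index
  -- `i` serves as that file. The excess lives on clean queries: `a * K / N` for each of the `M`
  -- files, except the reference one.
  have hdiff := Fintype.sum_of_injective (WBUQuery.clean : Fin M → WBUQuery N K M) hinj
    (fun k => a * (K / N) - if i = k then a * (K / N) else 0)
    (fun q => (⨆ m, ((wbuLaw hKN p m).map (fun q => q l) q).toReal) -
      ((wbuLaw hKN p i).map (fun q => q l) q).toReal)
    (fun q hq => by simp only [hconst q hq, ciSup_const, sub_self])
    (fun k => by rw [hsup, hclean])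
  rw [sum_sub_distrib, sum_sub_distrib, PMF.sum_toReal, sum_const, card_univ, Fintype.card_fin,
    sum_ite_eq, if_pos (mem_univ _), nsmul_eq_mul] at hdiff
  rw [sub_eq_iff_eq_add'.1 hdiff.symm]
  ring

theorem wbuScheme_maxLeakage {F : Type*} [Field F] {G : Matrix (Fin K) (Fin N) F} (hM : 2 ≤ M)
    (hN : 0 < N) (hKN : K ≤ N) {p : PMF (Fin M)}
    {i j : Fin M} (hi : i.1 = 0) (hj : j.1 = M - 1) (hp : ∀ m, m ≠ i ∧ m ≠ j → p m = 0) :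
    (wbuScheme hKN G p).maxLeakage =
      Real.logb 2 (1 + (p i).toReal * (K * ((M : ℝ) - 1) / N)) := by
  have : Nonempty (Fin N) := ⟨⟨0, hN⟩⟩
  rw [IRScheme.maxLeakage]
  exact (iSup_congr fun l => congrArg (Real.logb 2) (sum_iSup_map_wbuLaw hM hKN hi hj hp l)).trans
    ciSup_const

end Scheme

/-! ### The two-point distribution and the final formulas -/

/-- There is a probability distribution with mass `a` at `i` and mass `1 - a` at `j`. -/
theorem exists_pmf_two_point {α : Type*} [Fintype α] {i j : α} (hij : i ≠ j) {a : ℝ} (h0 : 0 ≤ a)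
    (h1 : a ≤ 1) :
    ∃ p : PMF α, (p i).toReal = a ∧ (p j).toReal = 1 - a ∧ ∀ m, m ≠ i ∧ m ≠ j → p m = 0 := by
  classical
  let f : α → ENNReal := fun m => if m = i then ENNReal.ofReal a else
    if m = j then ENNReal.ofReal (1 - a) else 0
  have hf : ∑ m, f m = 1 := by
    rw [Fintype.sum_eq_add _ _ hij fun m hm => by simp only [f, if_neg hm.1, if_neg hm.2]]
    simp only [f, if_pos, if_neg hij.symm]
    rw [← ENNReal.ofReal_add h0 (sub_nonneg.2 h1), add_sub_cancel, ENNReal.ofReal_one]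
  refine ⟨PMF.ofFintype f hf, ?_, ?_, fun m hm => ?_⟩
  · rw [PMF.ofFintype_apply]
    simp only [f, if_pos, ENNReal.toReal_ofReal h0]
  · rw [PMF.ofFintype_apply]
    simp only [f, if_neg hij.symm, if_pos, ENNReal.toReal_ofReal (sub_nonneg.2 h1)]
  · rw [PMF.ofFintype_apply]
    simp only [f, if_neg hm.1, if_neg hm.2]

theorem theorem4 {F : Type*} [Field F] [Fintype F] (N K M : ℕ) (hK : 1 ≤ K) (hKN : K ≤ N)
    (hM : 2 ≤ M) (G : Matrix (Fin K) (Fin N) F) (hG : IsMDSGenerator G) (ρ : ℝ) (hρ : 0 ≤ ρ) :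
    ∃ p : PMF (Fin M),
      (p ⟨0, by omega⟩).toReal = min (N * ((2 : ℝ) ^ ρ - 1) / (K * ((M : ℝ) - 1))) 1 ∧
      (p ⟨M - 1, by omega⟩).toReal = 1 - min (N * ((2 : ℝ) ^ ρ - 1) / (K * ((M : ℝ) - 1))) 1 ∧
      (wbuScheme hKN G p).IsCorrect ∧
      (wbuScheme hKN G p).maxLeakage = min ρ (Real.logb 2 (1 + K * ((M : ℝ) - 1) / N)) ∧
      (wbuScheme hKN G p).rate =
        (1 + max (1 - N * ((2 : ℝ) ^ ρ - 1) / (K * ((M : ℝ) - 1))) 0 *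
          ∑ i ∈ Finset.Icc 1 (M - 1), ((K : ℝ) / N) ^ i)⁻¹ := by
  have hN : 0 < N := by omega
  have hN' : (0 : ℝ) < N := by exact_mod_cast hN
  have hK' : (0 : ℝ) < K := by exact_mod_cast hK
  have hM' : (0 : ℝ) < (M : ℝ) - 1 := by
    have : (2 : ℝ) ≤ M := by exact_mod_cast hM
    linarith
  have hρ' : (1 : ℝ) ≤ 2 ^ ρ := Real.one_le_rpow one_le_two hρ
  set b : ℝ := N * ((2 : ℝ) ^ ρ - 1) / (K * ((M : ℝ) - 1)) with hb
  have hb0 : 0 ≤ b := div_nonneg (mul_nonneg hN'.le (sub_nonneg.2 hρ')) (by positivity)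
  have hij : (⟨0, by omega⟩ : Fin M) ≠ ⟨M - 1, by omega⟩ := fun h => by
    have := Fin.mk.inj h
    omega
  obtain ⟨p, h0, h1, hp⟩ :=
    exists_pmf_two_point hij (le_min hb0 zero_le_one) (min_le_right b (1 : ℝ))
  refine ⟨p, h0, h1, wbuScheme_isCorrect hKN hG p, ?_, ?_⟩
  · have hc : 0 < K * ((M : ℝ) - 1) / N := by positivity
    -- `b` is chosen so that `1 + b * c = 2 ^ ρ` with `c = K * (M - 1) / N`. The cap at 1 then
    -- becomes the minimum of the two leakages, as the logarithm is monotone.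
    have hbc : b * (K * ((M : ℝ) - 1) / N) = 2 ^ ρ - 1 := by
      rw [hb]
      field_simp
    rw [wbuScheme_maxLeakage hM hN hKN rfl rfl hp, h0, min_mul_of_nonneg _ _ hc.le, hbc, one_mul,
      ← min_add_add_left, add_sub_cancel,
      (Real.strictMonoOn_logb one_lt_two).monotoneOn.map_min (Set.mem_Ioi.2 (by positivity))
        (Set.mem_Ioi.2 (by positivity)), Real.logb_rpow two_pos (by norm_num)]
  · have hs : ∑ i ∈ range M, ((K : ℝ) / N) ^ i =
        1 + ∑ i ∈ Finset.Icc 1 (M - 1), ((K : ℝ) / N) ^ i := by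
      rw [range_eq_Ico, sum_eq_sum_Ico_succ_bot (by omega), pow_zero]
      congr 2
    -- With `a = min b 1` and `S` the sum from 1 on, the rate's denominator is `a + (1 - a) * (1 +
    -- S) = 1 + (1 - a) * S`.
    have hmax : max (1 - b) 0 = 1 - min b 1 := by
      rcases le_total b 1 with h | h
      · rw [min_eq_left h, max_eq_left (by linarith)]
      · rw [min_eq_right h, max_eq_right (by linarith), sub_self]
    rw [wbuScheme_rate hM hK hKN rfl rfl hp, h0, h1, hs, hmax]
    ring
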